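/- Let $M$ be a smooth ($C^\infty$) surface diffeomorphic to the unit sphere $S^2\subset\mathbb{R}^3$. Let $N\subset M$ be a compact embedded smooth $1$-dimensional submanifold without boundary (possibly empty), and for every connected component $C$ of $M\setminus N$ let $\mathcal{X}_C$ be a smooth vector field on $M$. Let $\mathcal{Z}$ be the Filippov vector field on $M$ with non-smoothness manifold $N$ given by $\mathcal{Z}(p)=\mathcal{X}_C(p)$ for $p\in C$. Then $\mathcal{Z}$ has at least one singularity in the Filippov sense. Here singularities are defined as follows. A local description of $\mathcal{Z}$ consists of a smooth chart $\Phi:U\to D\subset\mathbb{R}^2$ of $M$, a smooth function $f:D\to\mathbb{R}$ having $0$ as a regular value with $\Phi(N\cap U)=f^{-1}(0)$, and components $C^+,C^-$ of $M\setminus N$ with $\{p\in U: f(\Phi(p))>0\}\subset C^+$ and $\{p\in U: f(\Phi(p))<0\}\subset C^-$. Put $F^\pm=\Phi_*\mathcal{X}_{C^\pm}$ and $F^\pm f(\mathbf{x})=\langle\nabla f(\mathbf{x}),F^\pm(\mathbf{x})\rangle$. A point $p\in M$ is a singularity of $\mathcal{Z}$ if for some local description with $p\in U$ the point $\mathbf{x}=\Phi(p)$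 satisfies one of the following conditions: (a) $f(\mathbf{x})\ge 0$ and $F^+(\mathbf{x})=0$, or $f(\mathbf{x})\le 0$ and $F^-(\mathbf{x})=0$; (b) $f(\mathbf{x})=0$, the numbers $F^+f(\mathbf{x})$ and $F^-f(\mathbf{x})$ are nonzero of opposite signs, and the sliding vector field $$Z^s(\mathbf{x})=\frac{F^-f(\mathbf{x})\,F^+(\mathbf{x})-F^+f(\mathbf{x})\,F^-(\mathbf{x})}{F^-f(\mathbf{x})-F^+f(\mathbf{x})}$$ vanishes; (c) $f(\mathbf{x})=0$, and $F^+f(\mathbf{x})=0$ or $F^-f(\mathbf{x})=0$. -/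

import Mathlib

open scoped Manifold ContDiff

/-- The coordinate plane `ℝ²`. -/
abbrev Plane : Type := EuclideanSpace ℝ (Fin 2)

namespace PlanarFilippov

/-- The Lie derivative `F f (x) = ⟨∇ f (x), F (x)⟩` of `f` in the direction of the vector
field `F`, i.e. the derivative of `f` at `x` applied to the vector `F x`. -/
noncomputable def lieDeriv (F : Plane → Plane) (f : Plane → ℝ) (x : Plane) : ℝ :=
  fderiv ℝ f x (F x)

/-- `x` lies in the sliding region of `(F⁺, F⁻)_f`. -/
def IsSliding (f : Plane → ℝ) (Fpos Fneg : Plane → Plane) (x : Plane) : Prop :=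
  f x = 0 ∧ lieDeriv Fpos f x < 0 ∧ 0 < lieDeriv Fneg f x

/-- `x` lies in the escaping region of `(F⁺, F⁻)_f`. -/
def IsEscaping (f : Plane → ℝ) (Fpos Fneg : Plane → Plane) (x : Plane) : Prop :=
  f x = 0 ∧ 0 < lieDeriv Fpos f x ∧ lieDeriv Fneg f x < 0

/-- The sliding vector field
`Zˢ = (F⁻f • F⁺ - F⁺f • F⁻) / (F⁻f - F⁺f)`; the denominator is nonzero in the sliding and
escaping regions, the only places where it is used. -/
noncomputable def slidingField (f : Plane → ℝ) (Fpos Fneg : Plane → Plane) (x : Plane) : Plane :=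
  (lieDeriv Fneg f x - lieDeriv Fpos f x)⁻¹ •
    (lieDeriv Fneg f x • Fpos x - lieDeriv Fpos f x • Fneg x)

/-- Singularities of the planar Filippov vector field `(F⁺, F⁻)_f`, equal to `F⁺` where `f ≥ 0`
and to `F⁻` where `f ≤ 0`: equilibria of `F⁺` or `F⁻` in their closed sides (boundary equilibria
included), pseudo-equilibria, and tangential singularities. -/
def IsSingularity (f : Plane → ℝ) (Fpos Fneg : Plane → Plane) (x : Plane) : Prop :=
  ((0 ≤ f x ∧ Fpos x = 0) ∨ (f x ≤ 0 ∧ Fneg x = 0)) ∨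
  ((IsSliding f Fpos Fneg x ∨ IsEscaping f Fpos Fneg x) ∧ slidingField f Fpos Fneg x = 0) ∨
  (f x = 0 ∧ (lieDeriv Fpos f x = 0 ∨ lieDeriv Fneg f x = 0))

end PlanarFilippov

/-- `N` is a compact embedded `1`-dimensional submanifold (without boundary) of the smooth surface
`M`: it is compact, and each of its points has a smooth chart of `M` in which `N` is the straight
segment `{y = 0}`. -/
structure IsCompactCurve {M : Type*} [TopologicalSpace M] [ChartedSpace Plane M]
    (N : Set M) : Prop where
  isCompact : IsCompact N
  exists_slice_chart : ∀ q ∈ N, ∃ Φ ∈ IsManifold.maximalAtlas (𝓡 2) ∞ M,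
    q ∈ Φ.source ∧ ∀ p ∈ Φ.source, p ∈ N ↔ (Φ p) 1 = 0

/-- A Filippov vector field on the smooth surface `M`: a non-smoothness manifold `N`, and for
each connected component `C` of `M \ N` a vector field `X C`, smooth on all of `M`. The piecewise
smooth vector field takes the value `X C p` at `p ∈ C`. -/
structure FilippovVectorField (M : Type*) [TopologicalSpace M] [ChartedSpace Plane M]
    [IsManifold (𝓡 2) ∞ M] where
  /-- the non-smoothness manifold -/
  N : Set M
  isCompactCurve : IsCompactCurve N
  /-- the smooth vector field attached to a connected component of the complement of `N` -/
  X : ConnectedComponents (Nᶜ : Set M) → (p : M) → TangentSpace (𝓡 2) p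
  smooth : ∀ C, ContMDiff (𝓡 2) (𝓡 2).tangent ∞
    (fun p => (⟨p, X C p⟩ : TangentBundle (𝓡 2) M))

namespace FilippovVectorField

variable {M : Type*} [TopologicalSpace M] [ChartedSpace Plane M] [IsManifold (𝓡 2) ∞ M]

/-- A description of a Filippov vector field in local coordinates: a chart `Φ : U → D` of `M` and
a smooth `f : D → ℝ` with regular value `0` whose zero set is the image of `N ∩ U`, such that the
parts of `U` on which `f ∘ Φ > 0` and `f ∘ Φ < 0` each lie in one component of `M \ N`.
If `N` does not meet `U`, then `f` has no zero and one of the two parts may be empty. -/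
structure LocalDescription (Z : FilippovVectorField M) where
  /-- the chart -/
  Φ : OpenPartialHomeomorph M Plane
  mem_maximalAtlas : Φ ∈ IsManifold.maximalAtlas (𝓡 2) ∞ M
  /-- the function that separates the two sides -/
  f : Plane → ℝ
  smooth_f : ContDiffOn ℝ ∞ f Φ.target
  regular : ∀ x ∈ Φ.target, f x = 0 → fderiv ℝ f x ≠ 0
  mem_N_iff : ∀ p ∈ Φ.source, p ∈ Z.N ↔ f (Φ p) = 0
  /-- the component of `M \ N` that contains the side `f > 0` -/
  Cpos : ConnectedComponents (Z.Nᶜ : Set M)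
  /-- the component of `M \ N` that contains the side `f < 0` -/
  Cneg : ConnectedComponents (Z.Nᶜ : Set M)
  pos_side : ∀ p : (Z.Nᶜ : Set M), (p : M) ∈ Φ.source → 0 < f (Φ p) →
    ConnectedComponents.mk p = Cpos
  neg_side : ∀ p : (Z.Nᶜ : Set M), (p : M) ∈ Φ.source → f (Φ p) < 0 →
    ConnectedComponents.mk p = Cneg

/-- The pushforward `Φ_* X` of a vector field on `M` by a chart `Φ` (used on `Φ.target`). -/
noncomputable def pushforward (Φ : OpenPartialHomeomorph M Plane)
    (X : (p : M) → TangentSpace (𝓡 2) p) (x : Plane) : Plane :=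
  mfderiv (𝓡 2) (𝓡 2) Φ (Φ.symm x) (X (Φ.symm x))

namespace LocalDescription

variable {Z : FilippovVectorField M}

/-- The local vector field `F⁺`, relevant where `f ≥ 0`. -/
noncomputable def Fpos (L : LocalDescription Z) : Plane → Plane :=
  pushforward L.Φ (Z.X L.Cpos)

/-- The local vector field `F⁻`, relevant where `f ≤ 0`. -/
noncomputable def Fneg (L : LocalDescription Z) : Plane → Plane :=
  pushforward L.Φ (Z.X L.Cneg)

end LocalDescription

/-- `p` is a singularity of `Z` (in the Filippov sense) if, in some local description of `Z` around
`p`, its image is a singularity of the planar Filippov vector field `(F⁺, F⁻)_f`. -/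
def IsSingularity (Z : FilippovVectorField M) (p : M) : Prop :=
  ∃ L : LocalDescription Z, p ∈ L.Φ.source ∧
    PlanarFilippov.IsSingularity L.f L.Fpos L.Fneg (L.Φ p)

end FilippovVectorField

/-! Suppose there is no singularity. If a convex combination of the two one-sided vectors vanished
at a point of `N`, applying the derivative of `f` would give a vanishing combination of `F⁺f` and
`F⁻f`; both are nonzero, so they have opposite signs and the combination is the sliding vector, a
pseudo-equilibrium (`convexCombination_ne_zero`). Hence the segment between the two vectors misses
the origin, and some `w` has positive inner product with both (`exists_inner_pos_of_segment`). This
condition on `w` is convex and a constant solution works locally, so the solutions glue to a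
continuous map on the sphere. Its tangential part has the same inner products with tangent vectors,
so it never vanishes, against the hairy ball theorem.

The latter compares logarithms of the field in two stereographic frames: on the equator they would
yield a continuous logarithm of `z ^ 2`. -/

/-! ### The hairy ball theorem on the 2-sphere. -/

section HairyBall

/-- A nowhere zero continuous function on the complex plane has a continuous logarithm. -/
theorem Complex.exists_continuous_exp_eq {g : ℂ → ℂ} (hg : Continuous g) (h0 : ∀ z, g z ≠ 0) :
    ∃ f : ℂ → ℂ, Continuous f ∧ ∀ z, exp (f z) = g z := by
  obtain ⟨F, ⟨-, hF⟩, -⟩ := Complex.isCoveringMapOn_exp.existsUnique_continuousMap_lifts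
    ⟨g, hg⟩ (Complex.exp_log (h0 0)) (fun z => by simpa using h0 z)
  exact ⟨F, F.continuous, fun z => congrFun hF z⟩

/-- The square function has no continuous logarithm on the unit circle. -/
theorem Complex.not_exists_exp_eq_sq_on_circle {G : ℂ → ℂ} (hG : Continuous G) :
    ¬ ∀ z : ℂ, ‖z‖ = 1 → exp (G z) = z ^ 2 := by
  intro h
  -- `u` takes values in the discrete fibre of `exp` over 1, so it is constant, yet it drops by
  -- `4πi` over one turn.
  let u : ℝ → ℂ := fun θ => G (exp (θ * I)) - 2 * θ * I
  have hu : Continuous u := by fun_prop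
  have hu1 : ∀ θ, exp (u θ) = 1 := fun θ => by
    simp only [u, exp_sub, h _ (norm_exp_ofReal_mul_I θ), ← exp_nat_mul]
    rw [div_eq_one_iff_eq (exp_ne_zero _)]
    congr 1
    push_cast
    ring
  have hconst : ∀ θ, u θ = u 0 := by
    have hdisc : IsSeparatedMap (fun z : ℂ => (⟨_, z.exp_ne_zero⟩ : {z : ℂ // z ≠ 0})) :=
      Complex.isCoveringMap_exp.isSeparatedMap
    have := hdisc.const_of_comp Complex.isCoveringMap_exp.isLocalHomeomorph.isLocallyInjective hu
      (fun a a' => Subtype.ext ((hu1 a).trans (hu1 a').symm))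
    exact fun θ => this θ 0
  have h1 := hconst (2 * Real.pi)
  simp only [u] at h1
  rw [show ((2 * Real.pi : ℝ) : ℂ) * I = 2 * Real.pi * I by push_cast; ring, exp_two_pi_mul_I] at h1
  simp [Real.pi_ne_zero] at h1

local notation "E3" => EuclideanSpace ℝ (Fin 3)

theorem EuclideanSpace.sq_add_sq_add_sq_of_mem_sphere {p : E3} (hp : p ∈ Metric.sphere (0 : E3) 1) :
    p 0 ^ 2 + p 1 ^ 2 + p 2 ^ 2 = 1 := by
  have := EuclideanSpace.norm_sq_eq p
  rw [mem_sphere_zero_iff_norm.1 hp] at this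
  simpa [Fin.sum_univ_three] using this.symm

/-- The inverse stereographic projection of the complex plane to the unit sphere, from the south
pole if `s = 1` and from the north pole if `s = -1`. -/
noncomputable def invStereo (s : ℝ) (z : ℂ) : E3 :=
  !₂[2 * z.re / (1 + Complex.normSq z), 2 * z.im / (1 + Complex.normSq z),
    s * (1 - Complex.normSq z) / (1 + Complex.normSq z)]

theorem one_add_normSq_pos (z : ℂ) : 0 < 1 + Complex.normSq z := by
  have := Complex.normSq_nonneg z
  linarith

theorem invStereo_mem_sphere {s : ℝ} (hs : s ^ 2 = 1) (z : ℂ) :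
    invStereo s z ∈ Metric.sphere (0 : E3) 1 := by
  have h := (one_add_normSq_pos z).ne'
  have h2 : Complex.normSq z = z.re ^ 2 + z.im ^ 2 := by rw [Complex.normSq_apply]; ring
  rw [mem_sphere_zero_iff_norm, EuclideanSpace.norm_eq, Real.sqrt_eq_one]
  simp only [invStereo, Fin.sum_univ_three, Real.norm_eq_abs, sq_abs]
  simp only [Matrix.cons_val_zero, Matrix.cons_val_one, Matrix.cons_val]
  field_simp
  rw [hs, h2]
  ring

theorem continuous_invStereo (s : ℝ) : Continuous (invStereo s) := by
  have h : ∀ z : ℂ, 1 + Complex.normSq z ≠ 0 := fun z => (one_add_normSq_pos z).ne'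
  have hc := Complex.continuous_normSq
  have hre := Complex.continuous_re
  have him := Complex.continuous_im
  refine (PiLp.continuous_toLp 2 _).comp (continuous_pi fun i => ?_)
  fin_cases i
  · exact (by fun_prop : Continuous fun z : ℂ => 2 * z.re).div (by fun_prop) h
  · exact (by fun_prop : Continuous fun z : ℂ => 2 * z.im).div (by fun_prop) h
  · exact (by fun_prop : Continuous fun z : ℂ => s * (1 - Complex.normSq z)).div (by fun_prop) h

theorem one_add_mul_invStereo_ne_zero {s : ℝ} (hs : s ^ 2 = 1) (z : ℂ) :
    1 + s * invStereo s z 2 ≠ 0 := by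
  have h := (one_add_normSq_pos z).ne'
  have : 1 + s * invStereo s z 2 = 2 / (1 + Complex.normSq z) := by
    simp only [invStereo, PiLp.toLp_apply, Matrix.cons_val]
    field_simp
    rw [hs]
    ring
  rw [this]
  positivity

theorem invStereo_of_norm_eq_one (s : ℝ) {z : ℂ} (hz : ‖z‖ = 1) :
    invStereo s z = !₂[z.re, z.im, 0] := by
  have : Complex.normSq z = 1 := by rw [Complex.normSq_eq_norm_sq, hz, one_pow]
  simp only [invStereo, this]
  congr 1
  ext i
  fin_cases i <;> simp <;> ring

/-- The component functions, as one complex number, of a vector `v` at a point `p` of the sphere in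
the conformal frame given by a stereographic projection (with `s` as in `invStereo`). -/
noncomputable def stereoCoord (s : ℝ) (p v : E3) : ℂ :=
  ⟨v 0 * (1 + s * p 2) - s * p 0 * v 2, v 1 * (1 + s * p 2) - s * p 1 * v 2⟩

/-- Up to the factor `(1 + s * p 2) ^ 2`, `stereoCoord` is the differential of stereographic
projection, which is injective on tangent planes away from the pole. -/
theorem stereoCoord_ne_zero {s : ℝ} (hs : s ^ 2 = 1) {p v : E3}
    (hp : p ∈ Metric.sphere (0 : E3) 1) (hps : 1 + s * p 2 ≠ 0)
    (hpv : p 0 * v 0 + p 1 * v 1 + p 2 * v 2 = 0) (hv : v ≠ 0) : stereoCoord s p v ≠ 0 := by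
  intro h
  have h0 : v 0 * (1 + s * p 2) - s * p 0 * v 2 = 0 := congrArg Complex.re h
  have h1 : v 1 * (1 + s * p 2) - s * p 1 * v 2 = 0 := congrArg Complex.im h
  have hn := EuclideanSpace.sq_add_sq_add_sq_of_mem_sphere hp
  have hs0 : s ≠ 0 := by rintro rfl; norm_num at hs
  have h2 : v 2 = 0 := by
    have : (s * (1 + s * p 2)) * v 2 = 0 := by
      linear_combination (-(p 0)) * h0 - p 1 * h1 + (1 + s * p 2) * hpv - s * v 2 * hn
        + p 2 * v 2 * hs
    exact (mul_eq_zero.1 this).resolve_left (mul_ne_zero hs0 hps)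
  rw [h2, mul_zero, sub_zero] at h0 h1
  apply hv
  ext i
  fin_cases i
  · exact (mul_eq_zero.1 h0).resolve_right hps
  · exact (mul_eq_zero.1 h1).resolve_right hps
  · exact h2

/-- The two projections differ by `z ↦ 1 / conj z`, whose differential on the unit circle is `ζ ↦
-z² conj ζ`. -/
theorem stereoCoord_neg_one_of_norm_eq_one {z : ℂ} (hz : ‖z‖ = 1) {v : E3}
    (hv : z.re * v 0 + z.im * v 1 = 0) :
    stereoCoord (-1) !₂[z.re, z.im, 0] v =
      -(z ^ 2 * (starRingEnd ℂ) (stereoCoord 1 !₂[z.re, z.im, 0] v)) := by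
  have hn : z.re ^ 2 + z.im ^ 2 = 1 := by
    have : Complex.normSq z = 1 := by rw [Complex.normSq_eq_norm_sq, hz, one_pow]
    rw [← this, Complex.normSq_apply]
    ring
  apply Complex.ext
  · simp [stereoCoord, pow_two]
    linear_combination (-(v 0) - z.re * v 2) * hn + 2 * z.re * hv
  · simp [stereoCoord, pow_two]
    linear_combination (-(v 1) - z.im * v 2) * hn + 2 * z.im * hv

/-- The **hairy ball theorem** on the two-dimensional sphere: a continuous tangent vector field has
a zero. -/
theorem exists_eq_zero_of_tangent_sphere {v : Metric.sphere (0 : E3) 1 → E3} (hv : Continuous v)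
    (htan : ∀ p : Metric.sphere (0 : E3) 1, inner ℝ (p : E3) (v p) = 0) : ∃ p, v p = 0 := by
  by_contra! hne
  have key : ∀ s : ℝ, s ^ 2 = 1 → ∃ f : ℂ → ℂ, Continuous f ∧ ∀ z (hz : ‖z‖ = 1)
      (p : Metric.sphere (0 : E3) 1), (p : E3) = !₂[z.re, z.im, 0] →
      Complex.exp (f z) = stereoCoord s !₂[z.re, z.im, 0] (v p) := by
    intro s hs
    let P : ℂ → Metric.sphere (0 : E3) 1 := fun z => ⟨invStereo s z, invStereo_mem_sphere hs z⟩
    have hP : Continuous P := (continuous_invStereo s).subtype_mk _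
    have hc : Continuous fun z => stereoCoord s (P z) (v (P z)) := by
      have h1 : Continuous fun z => v (P z) := hv.comp hP
      have h2 : Continuous fun z => (P z : E3) := continuous_invStereo s
      have : ∀ p v, stereoCoord s p v =
          ((v 0 * (1 + s * p 2) - s * p 0 * v 2 : ℝ) : ℂ) +
          ((v 1 * (1 + s * p 2) - s * p 1 * v 2 : ℝ) : ℂ) * Complex.I := fun p v =>
        Complex.mk_eq_add_mul_I _ _
      simp only [this]
      fun_prop
    obtain ⟨f, hf, hfe⟩ := Complex.exists_continuous_exp_eq hc fun z =>
      stereoCoord_ne_zero hs (P z).2 (one_add_mul_invStereo_ne_zero hs z) (by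
        have := htan (P z)
        simp only [PiLp.inner_apply, Fin.sum_univ_three, RCLike.inner_apply, conj_trivial] at this
        linarith) (hne _)
    refine ⟨f, hf, fun z hz p hp => ?_⟩
    have : P z = p := Subtype.ext ((invStereo_of_norm_eq_one s hz).trans hp.symm)
    rw [hfe, this, hp]
  obtain ⟨f, hf, hfe⟩ := key 1 (by norm_num)
  obtain ⟨g, hg, hge⟩ := key (-1) (by norm_num)
  refine Complex.not_exists_exp_eq_sq_on_circle
    (G := fun z => g z - (starRingEnd ℂ) (f z) + Real.pi * Complex.I)
    (by have := Complex.continuous_conj.comp hf; fun_prop) fun z hz => ?_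
  have hp : (!₂[z.re, z.im, 0] : E3) ∈ Metric.sphere (0 : E3) 1 := by
    rw [← invStereo_of_norm_eq_one 1 hz]
    exact invStereo_mem_sphere (by norm_num) z
  have ht := htan ⟨_, hp⟩
  simp [PiLp.inner_apply, Fin.sum_univ_three] at ht
  rw [Complex.exp_add, Complex.exp_sub, Complex.exp_pi_mul_I, Complex.exp_conj,
    hfe z hz ⟨_, hp⟩ rfl, hge z hz ⟨_, hp⟩ rfl,
    stereoCoord_neg_one_of_norm_eq_one hz (by linarith), ← hfe z hz ⟨_, hp⟩ rfl, ← Complex.exp_conj]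
  have := Complex.exp_ne_zero ((starRingEnd ℂ) (f z))
  field_simp

end HairyBall

/-! ### Convex combinations at non-singular points. -/

namespace PlanarFilippov

/-- At a boundary point that is not a singularity, no convex combination of the two vectors
vanishes. -/
theorem convexCombination_ne_zero {f : Plane → ℝ} {Fpos Fneg : Plane → Plane} {x : Plane}
    (hf : f x = 0) (h : ¬ IsSingularity f Fpos Fneg x) {a b : ℝ} (ha : 0 ≤ a) (hb : 0 ≤ b)
    (hab : a + b = 1) : a • Fpos x + b • Fneg x ≠ 0 := by
  intro h0
  simp only [IsSingularity, not_or, not_and] at h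
  obtain ⟨-, hs, ht⟩ := h
  obtain ⟨hp, hm⟩ := ht hf
  have hl : a * lieDeriv Fpos f x + b * lieDeriv Fneg f x = 0 := by
    have := congrArg (fderiv ℝ f x) h0
    simpa [lieDeriv] using this
  have ha' : 0 < a := ha.lt_of_ne' <| by
    rintro rfl
    obtain rfl : b = 1 := by linarith
    exact hm (by linarith)
  have hb' : 0 < b := hb.lt_of_ne' <| by
    rintro rfl
    obtain rfl : a = 1 := by linarith
    exact hp (by linarith)
  have hsl : slidingField f Fpos Fneg x = 0 := by
    have : lieDeriv Fneg f x - lieDeriv Fpos f x ≠ 0 := by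
      intro h
      apply hp
      have : lieDeriv Fneg f x = lieDeriv Fpos f x := by linarith
      rw [this, ← add_mul, hab, one_mul] at hl
      exact hl
    -- With `c = F⁻f - F⁺f`, the weights are forced: `F⁻f = c a` and `F⁺f = -c b`, so the sliding
    -- numerator is `c` times the vanishing combination.
    have h1 : lieDeriv Fneg f x = (lieDeriv Fneg f x - lieDeriv Fpos f x) * a := by
      linear_combination hl - lieDeriv Fneg f x * hab
    have h2 : lieDeriv Fpos f x = -((lieDeriv Fneg f x - lieDeriv Fpos f x) * b) := by
      linear_combination hl - lieDeriv Fpos f x * hab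
    rw [slidingField, smul_eq_zero]
    right
    generalize lieDeriv Fneg f x - lieDeriv Fpos f x = c at h1 h2
    rw [h1, h2, neg_smul, sub_neg_eq_add, mul_smul, mul_smul, ← smul_add, h0, smul_zero]
  refine hs ?_ hsl
  rcases lt_or_gt_of_ne hp with h | h
  · exact Or.inl ⟨hf, h, by by_contra! h'; nlinarith⟩
  · exact Or.inr ⟨hf, h, by by_contra! h'; nlinarith⟩

end PlanarFilippov

/-- Two vectors whose segment avoids the origin lie in a common open half space. -/
theorem exists_inner_pos_of_segment {E : Type*} [NormedAddCommGroup E] [InnerProductSpace ℝ E]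
    [CompleteSpace E] {u v : E}
    (h : ∀ a b : ℝ, 0 ≤ a → 0 ≤ b → a + b = 1 → a • u + b • v ≠ 0) :
    ∃ w : E, 0 < inner ℝ w u ∧ 0 < inner ℝ w v := by
  have hc : IsClosed (segment ℝ u v) := by
    rw [segment_eq_image_lineMap]
    exact (isCompact_Icc.image (AffineMap.lineMap_continuous)).isClosed
  obtain ⟨f, c, h0, hf⟩ := geometric_hahn_banach_point_closed (convex_segment u v) hc
    (x := 0) (by rintro ⟨a, b, ha, hb, hab, h'⟩; exact h a b ha hb hab h')
  rw [map_zero] at h0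
  refine ⟨(InnerProductSpace.toDual ℝ E).symm f, ?_, ?_⟩ <;>
    rw [InnerProductSpace.toDual_symm_apply]
  · exact h0.trans (hf _ (left_mem_segment ℝ u v))
  · exact h0.trans (hf _ (right_mem_segment ℝ u v))

theorem ConnectedComponents.exists_forall_mk_eq_of_isPreconnected {X : Type*} [TopologicalSpace X]
    {A S : Set X} (hS : IsPreconnected S) (hne : S.Nonempty) (hSA : S ⊆ A) :
    ∃ C : ConnectedComponents A, ∀ p : A, (p : X) ∈ S → ConnectedComponents.mk p = C := by
  obtain ⟨q, hq⟩ := hne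
  refine ⟨ConnectedComponents.mk ⟨q, hSA hq⟩, fun p hp => ?_⟩
  have hpre : IsPreconnected ((↑) ⁻¹' S : Set A) := by
    rw [← Topology.IsInducing.subtypeVal.isPreconnected_image, Subtype.image_preimage_coe,
      Set.inter_eq_right.2 hSA]
    exact hS
  rw [ConnectedComponents.coe_eq_coe']
  exact hpre.subset_connectedComponent (x := ⟨q, hSA hq⟩) hq hp

/-- A chart can be restricted so that its image is a ball, inside a given open set. -/
theorem exists_mem_maximalAtlas_target_eq_ball {M : Type*} [TopologicalSpace M]
    [ChartedSpace Plane M] {Φ : OpenPartialHomeomorph M Plane}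
    (hΦ : Φ ∈ IsManifold.maximalAtlas (𝓡 2) ∞ M) {q : M} (hq : q ∈ Φ.source) {U : Set M}
    (hU : IsOpen U) (hqU : q ∈ U) :
    ∃ Ψ ∈ IsManifold.maximalAtlas (𝓡 2) ∞ M, ∃ r > 0, q ∈ Ψ.source ∧ Ψ.source ⊆ Φ.source ∩ U ∧
      (∀ p, Ψ p = Φ p) ∧ Ψ.target = Metric.ball (Φ q) r := by
  have h1 : IsOpen (Φ.target ∩ Φ.symm ⁻¹' U) := Φ.isOpen_inter_preimage_symm hU
  obtain ⟨r, hr, hball⟩ := Metric.isOpen_iff.1 h1 (Φ q)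
    ⟨Φ.map_source hq, by rw [Set.mem_preimage, Φ.left_inv hq]; exact hqU⟩
  have hV : IsOpen (Φ.source ∩ Φ ⁻¹' Metric.ball (Φ q) r) :=
    Φ.isOpen_inter_preimage Metric.isOpen_ball
  have hs : (Φ.restr (Φ.source ∩ Φ ⁻¹' Metric.ball (Φ q) r)).source =
      Φ.source ∩ Φ ⁻¹' Metric.ball (Φ q) r := by
    rw [Φ.restr_source' _ hV, ← Set.inter_assoc, Set.inter_self]
  refine ⟨Φ.restr (Φ.source ∩ Φ ⁻¹' Metric.ball (Φ q) r), restr_mem_maximalAtlas _ hΦ hV, r, hr,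
    ?_, ?_, fun _ => rfl, ?_⟩
  · rw [hs]
    exact ⟨hq, Metric.mem_ball_self hr⟩
  · rw [hs]
    rintro p ⟨hp, hp'⟩
    refine ⟨hp, ?_⟩
    have := (hball hp').2
    rwa [Set.mem_preimage, Φ.left_inv hp] at this
  · rw [← OpenPartialHomeomorph.image_source_eq_target, hs]
    ext x
    constructor
    · rintro ⟨p, hp, rfl⟩
      exact hp.2
    · intro hx
      have hxt := (hball hx).1
      exact ⟨Φ.symm x, ⟨Φ.map_target hxt, by rwa [Set.mem_preimage, Φ.right_inv hxt]⟩,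
        Φ.right_inv hxt⟩

/-! ### Local descriptions and adjacent components. -/

namespace FilippovVectorField

variable {M : Type*} [TopologicalSpace M] [ChartedSpace Plane M] [IsManifold (𝓡 2) ∞ M]

theorem exists_localDescription_of_notMem (Z : FilippovVectorField M) (hN : IsClosed Z.N) {q : M}
    (hq : q ∉ Z.N) : ∃ L : LocalDescription Z, q ∈ L.Φ.source ∧ L.Cpos = L.Cneg ∧ 0 < L.f (L.Φ q) := by
  obtain ⟨Ψ, hΨ, r, hr, hqΨ, hsub, -, ht⟩ := exists_mem_maximalAtlas_target_eq_ball
    (IsManifold.chart_mem_maximalAtlas (I := 𝓡 2) (n := ∞) q) (mem_chart_source Plane q)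
    hN.isOpen_compl hq
  have hpre : IsPreconnected Ψ.source := by
    rw [← Ψ.symm_image_target_eq_source, ht]
    exact (convex_ball _ _).isPreconnected.image _ (ht ▸ Ψ.continuousOn_symm)
  obtain ⟨C, hC⟩ := ConnectedComponents.exists_forall_mk_eq_of_isPreconnected hpre ⟨q, hqΨ⟩
    (fun p hp => (hsub hp).2)
  exact ⟨
    { Φ := Ψ
      mem_maximalAtlas := hΨ
      f := fun _ => 1
      smooth_f := contDiffOn_const
      regular := fun _ _ h => absurd h one_ne_zero
      mem_N_iff := fun p hp => iff_of_false (hsub hp).2 one_ne_zero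
      Cpos := C
      Cneg := C
      pos_side := fun p hp _ => hC p hp
      neg_side := fun p hp _ => hC p hp }, hqΨ, rfl, one_pos⟩

theorem exists_localDescription_of_mem (Z : FilippovVectorField M) {q : M}
    (hq : q ∈ Z.N) : ∃ L : LocalDescription Z, q ∈ L.Φ.source := by
  obtain ⟨Φ, hΦ, hqΦ, hN⟩ := Z.isCompactCurve.exists_slice_chart q hq
  obtain ⟨Ψ, hΨ, r, hr, hqΨ, hsub, hΨΦ, ht⟩ := exists_mem_maximalAtlas_target_eq_ball hΦ hqΦ
    isOpen_univ (Set.mem_univ q)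
  have hN' : ∀ p ∈ Ψ.source, p ∈ Z.N ↔ (Ψ p) 1 = 0 := fun p hp => by
    rw [hΨΦ]
    exact hN p (hsub hp).1
  have hq0 : (Φ q) 1 = 0 := (hN q hqΦ).1 hq
  let ℓ : Plane →L[ℝ] ℝ := EuclideanSpace.proj 1
  have side : ∀ s : ℝ, s ≠ 0 → ∃ C : ConnectedComponents (Z.Nᶜ : Set M), ∀ p : (Z.Nᶜ : Set M),
      (p : M) ∈ Ψ.source → 0 < s * (Ψ p) 1 → ConnectedComponents.mk p = C := by
    intro s hs
    let B : Set Plane := Metric.ball (Φ q) r ∩ {x | 0 < (s • ℓ) x}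
    have hB : Convex ℝ B := (convex_ball _ _).inter
      (convex_halfSpace_gt (s • ℓ).toLinearMap.isLinear 0)
    have hBt : B ⊆ Ψ.target := ht ▸ Set.inter_subset_left
    have hpre : IsPreconnected (Ψ.symm '' B) :=
      hB.isPreconnected.image _ (Ψ.continuousOn_symm.mono hBt)
    have hne : B.Nonempty := by
      -- The centre lies on `{y = 0}`, so half a radius along the second axis, with the sign of `s`,
      -- enters the required half ball.
      refine ⟨Φ q + EuclideanSpace.single 1 (SignType.sign s * (r / 2)), ?_, ?_⟩
      · rw [mem_ball_iff_norm, add_sub_cancel_left, PiLp.norm_single, norm_mul]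
        rcases lt_or_gt_of_ne hs with h | h <;> simp [h, abs_of_pos hr, hr]
      · change 0 < s * (Φ q + EuclideanSpace.single 1 (SignType.sign s * (r / 2)) : Plane) 1
        simp only [PiLp.add_apply, hq0, PiLp.single_apply, if_true, zero_add]
        rw [← mul_assoc, mul_comm s, sign_mul_self]
        positivity
    obtain ⟨C, hC⟩ := ConnectedComponents.exists_forall_mk_eq_of_isPreconnected hpre
      (hne.image _) (A := (Z.Nᶜ : Set M)) (by
        rintro _ ⟨x, hx, rfl⟩ hmem
        have h1 := (hN' _ (Ψ.map_target (hBt hx))).1 hmem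
        rw [Ψ.right_inv (hBt hx)] at h1
        have h2 : 0 < s * x 1 := hx.2
        rw [h1, mul_zero] at h2
        exact h2.false)
    exact ⟨C, fun p hp hpos => hC p
      ⟨Ψ p, ⟨ht ▸ Ψ.map_source hp, hpos⟩, Ψ.left_inv hp⟩⟩
  obtain ⟨Cp, hCp⟩ := side 1 one_ne_zero
  obtain ⟨Cm, hCm⟩ := side (-1) (by norm_num)
  exact ⟨
    { Φ := Ψ
      mem_maximalAtlas := hΨ
      f := ℓ
      smooth_f := ℓ.contDiff.contDiffOn
      regular := fun x _ _ h => by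
        rw [ContinuousLinearMap.fderiv] at h
        have : ℓ (EuclideanSpace.single 1 1) = 0 := by rw [h]; rfl
        simp [ℓ] at this
      mem_N_iff := hN'
      Cpos := Cp
      Cneg := Cm
      pos_side := fun p hp h => hCp p hp (by rwa [one_mul])
      neg_side := fun p hp h => hCm p hp (by rw [neg_one_mul]; exact neg_pos.2 h) }, hqΨ⟩

/-- The open subset of `M` underlying a component of the complement of the curve. -/
def componentSet (Z : FilippovVectorField M) (C : ConnectedComponents (Z.Nᶜ : Set M)) : Set M :=
  (↑) '' {p : (Z.Nᶜ : Set M) | ConnectedComponents.mk p = C}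

namespace LocalDescription

variable {Z : FilippovVectorField M} (L : LocalDescription Z)

theorem mk_eq {p : (Z.Nᶜ : Set M)} (hp : (p : M) ∈ L.Φ.source) :
    ConnectedComponents.mk p = L.Cpos ∨ ConnectedComponents.mk p = L.Cneg := by
  rcases lt_trichotomy (L.f (L.Φ p)) 0 with h | h | h
  · exact Or.inr (L.neg_side p hp h)
  · exact absurd ((L.mem_N_iff p hp).2 h) p.2
  · exact Or.inl (L.pos_side p hp h)

theorem eq_of_mem_closure {p : M} (hp : p ∈ L.Φ.source) {C : ConnectedComponents (Z.Nᶜ : Set M)}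
    (hC : p ∈ closure (Z.componentSet C)) : C = L.Cpos ∨ C = L.Cneg := by
  obtain ⟨_, hp', ⟨q, hq, rfl⟩⟩ := mem_closure_iff.1 hC _ L.Φ.open_source hp
  rw [← show ConnectedComponents.mk q = C from hq]
  exact L.mk_eq hp'

/-- `N` has no interior: if `f` vanished near a point, so would its derivative, against regularity.
-/
theorem mem_closure_compl {p : M} (hp : p ∈ L.Φ.source) : p ∈ closure (Z.Nᶜ) := by
  by_contra hcl
  have h1 : ∀ᶠ x in nhds (L.Φ p), L.f x = 0 := by
    have ht : ∀ᶠ x in nhds (L.Φ p), x ∈ L.Φ.target :=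
      L.Φ.open_target.mem_nhds (L.Φ.map_source hp)
    have hs : Filter.Tendsto L.Φ.symm (nhds (L.Φ p)) (nhds p) := by
      have := (L.Φ.continuousAt_symm (L.Φ.map_source hp)).tendsto
      rwa [L.Φ.left_inv hp] at this
    filter_upwards [ht, hs (isClosed_closure.isOpen_compl.mem_nhds hcl)] with x hx hx'
    have : L.Φ.symm x ∈ Z.N := by
      by_contra h
      exact hx' (subset_closure h)
    have := (L.mem_N_iff _ (L.Φ.map_target hx)).1 this
    rwa [L.Φ.right_inv hx] at this
  refine L.regular _ (L.Φ.map_source hp) h1.self_of_nhds ?_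
  have h2 : L.f =ᶠ[nhds (L.Φ p)] fun _ => 0 := h1
  rw [h2.fderiv_eq]
  simp

/-- Ensures that the positivity condition imposed on `w` in the main proof is nowhere vacuous. Only
two components occur near `p`, so closure commutes with their union. -/
theorem mem_closure_componentSet {p : M} (hp : p ∈ L.Φ.source) :
    ∃ C, p ∈ closure (Z.componentSet C) := by
  have h : p ∈ closure (Z.componentSet L.Cpos ∪ Z.componentSet L.Cneg) := by
    rw [mem_closure_iff]
    intro U hU hpU
    obtain ⟨x, ⟨hxU, hxs⟩, hxN⟩ := mem_closure_iff.1 (L.mem_closure_compl hp) _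
      (hU.inter L.Φ.open_source) ⟨hpU, hp⟩
    exact ⟨x, hxU, (L.mk_eq (p := ⟨x, hxN⟩) hxs).imp (fun h => ⟨⟨x, hxN⟩, h, rfl⟩)
      (fun h => ⟨⟨x, hxN⟩, h, rfl⟩)⟩
  rw [closure_union] at h
  exact h.elim (fun h => ⟨_, h⟩) (fun h => ⟨_, h⟩)

end LocalDescription

/-- At a point that is not a singularity, no convex combination of the vectors of the adjacent
components vanishes. -/
theorem exists_localDescription_convexCombination_ne_zero (Z : FilippovVectorField M)
    (hN : IsClosed Z.N) {q : M} (hq : ¬ Z.IsSingularity q) :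
    ∃ L : LocalDescription Z, q ∈ L.Φ.source ∧ ∀ a b : ℝ, 0 ≤ a → 0 ≤ b → a + b = 1 →
      a • Z.X L.Cpos q + b • Z.X L.Cneg q ≠ 0 := by
  by_cases hqN : q ∈ Z.N
  · obtain ⟨L, hL⟩ := Z.exists_localDescription_of_mem hqN
    refine ⟨L, hL, fun a b ha hb hab h => ?_⟩
    refine PlanarFilippov.convexCombination_ne_zero ((L.mem_N_iff q hL).1 hqN)
      (fun h' => hq ⟨L, hL, h'⟩) ha hb hab ?_
    have h1 : ∀ C, pushforward L.Φ (Z.X C) (L.Φ q) = mfderiv (𝓡 2) (𝓡 2) L.Φ q (Z.X C q) := by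
      intro C
      rw [pushforward, L.Φ.left_inv hL]
    rw [LocalDescription.Fpos, LocalDescription.Fneg, h1, h1]
    have := congrArg (mfderiv (𝓡 2) (𝓡 2) L.Φ q) h
    rw [map_add, map_smul, map_smul, map_zero] at this
    exact this
  · obtain ⟨L, hL, hC, hf⟩ := Z.exists_localDescription_of_notMem hN hqN
    refine ⟨L, hL, fun a b ha hb hab h => hq ⟨L, hL, Or.inl (Or.inl ⟨hf.le, ?_⟩)⟩⟩
    rw [← hC, ← add_smul, hab, one_smul] at h
    rw [LocalDescription.Fpos, pushforward, L.Φ.left_inv hL, h, map_zero]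
    rfl

end FilippovVectorField

/-! ### Transport of tangent vectors to Euclidean space. -/

section SphereEmbedding

variable {M : Type*} [TopologicalSpace M] [ChartedSpace Plane M]

local notation "E3" => EuclideanSpace ℝ (Fin 3)

theorem fact_finrank_euclideanSpace_three : Fact (Module.finrank ℝ E3 = 2 + 1) :=
  ⟨finrank_euclideanSpace_fin⟩

attribute [local instance] fact_finrank_euclideanSpace_three

/-- The smooth map to space given by a diffeomorphism to the unit sphere. -/
noncomputable def Diffeomorph.toSpace
    (φ : Diffeomorph (𝓡 2) (𝓡 2) M (Metric.sphere (0 : E3) 1) ∞) : M → E3 := fun p => φ p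

variable (φ : Diffeomorph (𝓡 2) (𝓡 2) M (Metric.sphere (0 : E3) 1) ∞)

theorem Diffeomorph.contMDiff_toSpace : ContMDiff (𝓡 2) 𝓘(ℝ, E3) ∞ φ.toSpace :=
  (contMDiff_coe_sphere (n := 2)).comp φ.contMDiff

theorem Diffeomorph.mvfderiv_toSpace_apply (p : M) (v : TangentSpace (𝓡 2) p) :
    mvfderiv (𝓡 2) φ.toSpace p v =
      mvfderiv (𝓡 2) ((↑) : Metric.sphere (0 : E3) 1 → E3) (φ p) (mfderiv (𝓡 2) (𝓡 2) φ p v) := by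
  have h := mfderiv_comp p
    ((contMDiff_coe_sphere (n := 2) (E := E3) (m := ∞)).mdifferentiable (by simp) (φ p))
    (φ.contMDiff.mdifferentiable (by simp) p)
  exact congrArg (fun A : TangentSpace (𝓡 2) p →L[ℝ] E3 => A v) h

theorem Diffeomorph.mvfderiv_toSpace_injective (p : M) :
    Function.Injective (mvfderiv (𝓡 2) φ.toSpace p) := by
  intro u v huv
  rw [φ.mvfderiv_toSpace_apply, φ.mvfderiv_toSpace_apply] at huv
  exact (φ.mfderivToContinuousLinearEquiv (by simp) p).injective
    (injective_mvfderiv_subtypeVal_sphere _ huv)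

theorem Diffeomorph.inner_mvfderiv_toSpace (p : M) (v : TangentSpace (𝓡 2) p) :
    inner ℝ (φ p : E3) (mvfderiv (𝓡 2) φ.toSpace p v) = 0 := by
  rw [φ.mvfderiv_toSpace_apply, ← Submodule.mem_orthogonal_singleton_iff_inner_right,
    ← range_mvfderiv_subtypeVal (n := 2)]
  exact LinearMap.mem_range_self _ _

theorem Diffeomorph.continuous_mvfderiv_toSpace [IsManifold (𝓡 2) ∞ M]
    {X : (p : M) → TangentSpace (𝓡 2) p}
    (hX : ContMDiff (𝓡 2) (𝓡 2).tangent ∞ (fun p => (⟨p, X p⟩ : TangentBundle (𝓡 2) M))) :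
    Continuous fun p => mvfderiv (𝓡 2) φ.toSpace p (X p) := by
  have h1 := (φ.contMDiff_toSpace.continuous_tangentMap (by simp)).comp hX.continuous
  exact (contMDiff_snd_tangentBundle_modelSpace E3 𝓘(ℝ, E3) (n := 0)).continuous.comp h1

end SphereEmbedding

/-! ### Gluing and contradiction. -/

theorem mainTheorem3 {M : Type*} [TopologicalSpace M] [ChartedSpace Plane M]
    [IsManifold (𝓡 2) ∞ M]
    (hM : Nonempty (Diffeomorph (𝓡 2) (𝓡 2) M
      (Metric.sphere (0 : EuclideanSpace ℝ (Fin 3)) 1) ∞))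
    (Z : FilippovVectorField M) :
    ∃ p : M, Z.IsSingularity p := by
  obtain ⟨φ⟩ := hM
  by_contra! hZ
  have : T2Space M := φ.toHomeomorph.symm.t2Space
  have : CompactSpace M := φ.toHomeomorph.symm.compactSpace
  have hN : IsClosed Z.N := Z.isCompactCurve.isCompact.isClosed
  choose L hL hconv using fun q =>
    Z.exists_localDescription_convexCombination_ne_zero hN (hZ q)
  let Y : ConnectedComponents (Z.Nᶜ : Set M) → M → EuclideanSpace ℝ (Fin 3) :=
    fun C p => mvfderiv (𝓡 2) φ.toSpace p (Z.X C p)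
  have hY : ∀ C, Continuous (Y C) := fun C => φ.continuous_mvfderiv_toSpace (Z.smooth C)
  obtain ⟨w, hw⟩ := exists_continuous_forall_mem_convex_of_local_const
    -- Closures make the condition see the adjacent components at points of `N`, which lie in no
    -- component.
    (t := fun p => {w | ∀ C, p ∈ closure (Z.componentSet C) → 0 < inner ℝ w (Y C p)})
    (fun p u hu v hv a b ha hb hab C hC => by
      have hu' := hu C hC
      have hv' := hv C hC
      rw [inner_add_left, real_inner_smul_left, real_inner_smul_left]
      rcases ha.eq_or_lt with rfl | ha
      · obtain rfl : b = 1 := by linarith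
        linarith
      · have := mul_pos ha hu'
        have := mul_nonneg hb hv'.le
        linarith)
    (fun q => by
      obtain ⟨w, hpos, hneg⟩ := exists_inner_pos_of_segment (u := Y (L q).Cpos q)
        (v := Y (L q).Cneg q) fun a b ha hb hab h => hconv q a b ha hb hab <|
          φ.mvfderiv_toSpace_injective q <| by
            rw [map_add, map_smul, map_smul, map_zero]
            exact h
      refine ⟨w, ?_⟩
      have hev : ∀ C, 0 < inner ℝ w (Y C q) → ∀ᶠ p in nhds q, 0 < inner ℝ w (Y C p) :=
        fun C hC => (continuous_const.inner (hY C)).continuousAt.eventually_const_lt hC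
      filter_upwards [hev _ hpos, hev _ hneg, (L q).Φ.open_source.mem_nhds (hL q)]
        with p hp hm hs C hC
      rcases (L q).eq_of_mem_closure hs hC with rfl | rfl
      exacts [hp, hm])
  let v : Metric.sphere (0 : EuclideanSpace ℝ (Fin 3)) 1 → EuclideanSpace ℝ (Fin 3) :=
    fun x => w (φ.symm x) - inner ℝ (x : EuclideanSpace ℝ (Fin 3)) (w (φ.symm x)) • (x : _)
  have hwc : Continuous fun x => w (φ.symm x) := w.continuous.comp φ.symm.continuous
  obtain ⟨x, hx⟩ := exists_eq_zero_of_tangent_sphere (v := v)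
    (by have := continuous_subtype_val.inner (𝕜 := ℝ) hwc; fun_prop) fun x => by
      simp [v, inner_sub_right, real_inner_smul_right]
  obtain ⟨C, hC⟩ := (L (φ.symm x)).mem_closure_componentSet (hL _)
  have h1 := hw _ C hC
  have h2 := φ.inner_mvfderiv_toSpace (φ.symm x) (Z.X C (φ.symm x))
  rw [φ.apply_symm_apply] at h2
  -- At a zero of `v` the vector `w` is normal to the sphere, hence orthogonal to the tangent vector
  -- `Y C`.
  rw [sub_eq_zero.1 hx, real_inner_smul_left, h2, mul_zero] at h1
  exact h1.false
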